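/- **Setting.** A partition of $[0,\infty)$ is a sequence $\pi=(t_k)_{k\in\mathbb N}$ in $[0,\infty]$ with $t_0=0$, $t_k<t_{k+1}$ whenever $t_{k+1}<\infty$, and $t_k\to\infty$. Let $x:[0,\infty)\to\mathbb R$ be continuous, set $x_\infty:=0$, and let $(\pi_n)_n$ be a fixed sequence of partitions with $O_t(x,\pi_n)\to0$ for all $t\ge 0$, where $$O_t(x,\pi)=\sup\{|x_b-x_a| : a,b\in[t_k,t_{k+1})\cap[0,t]\text{ for some }k\}.$$ The discrete local time along $\pi$ is $$L^\pi_t(u)=2\sum_{j}\mathbf 1_{[\![x_{t_j\wedge t},\,x_{t_{j+1}\wedge t})\!)}(u)\,|x_{t_{j+1}\wedge t}-u|,\qquad [\![a,b)\!)=[a,b)\text{ if }a\le b,\ [b,a)\text{ if }a>b .$$ We write $x\in\mathcal L_1$ if for every $t\ge0$ the sequence $(L^{\pi_n}_t)_n$ converges weakly in $L^1(\mathbb R,du)$ to some $L_t$, and $t\mapsto L_t\in L^1(du)$ is continuous for the weak topology; $L_t$ is called the pathwise local time of $x$. A modification of it is a function $\ell_t(u)$ with $\ell_t=L_t$ Lebesgue-a.e.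 for each $t$. For $h:\mathbb R\to\mathbb R$ the Föllmer integral $\int_0^t h(x_s)\,dx_s$ is the limit of the sums $\sum_{t_j\in\pi_n}h(x_{t_j})(x_{t_{j+1}\wedge t}-x_{t_j\wedge t})$ as $n\to\infty$, when it exists uniformly for $t$ in compacts and is continuous in $t$. For convex $f:\mathbb R\to\mathbb R$, $f'_-$ is the left derivative and $f''$ the measure with $f''([a,b))=f'_-(b)-f'_-(a)$ for $a\le b$. A mollifier is a function $g:\mathbb R\to[0,\infty)$ of class $C^2$ with compact support contained in $[0,\infty)$ and $\int_{\mathbb R} g(u)\,du=1$; put $g_n(u)=n\,g(nu)$ and $f_n=g_n*f$. **Theorem.** Let $x\in\mathcal L_1$ have pathwise local time $L$, assume that $L$ has a modification, denoted $L_t(u)$ again, such that $u\mapsto L_t(u)$ is càdlàg for every $t$, and let $f:\mathbb R\to\mathbb R$ be convex. Then for every mollifier $g$ each $f_n$ is $C^2$, the Föllmer integrals $\int_0^t f_n'(x_s)\,dx_s$ exist, and for every $t\in[0,\infty)$ they converge as $n\to\infty$ to a finite limit, denoted $\int_0^t f'_-(x_s)\,dx_s$, which does not depend on the choice of $g$.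 Moreover, for every $t\ge0$, $L_t(\cdot)$ is $f''$-integrable and $$f(x_t)-f(x_0)=\int_0^t f'_-(x_s)\,dx_s+\frac12\int_{\mathbb R}L_t(u)\,f''(du).$$ If in addition $L_t(u)$ is jointly continuous in $t$ and càdlàg in $u$ (that is, for all $(t,u)$, $L_s(v)\to L_t(u)$ as $s\to t$ and $v\to u$ with $v\ge u$, and $L_s(v)$ has a finite limit as $s\to t$ and $v\to u$ with $v<u$), then for every mollifier the convergence is uniform for $t$ in compacts, and $t\mapsto\int_0^t f'_-(x_s)\,dx_s$ is continuous. -/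

import Mathlib

open Set Filter Topology MeasureTheory Function
open scoped NNReal ENNReal

namespace PathwiseTanaka

/-- A partition of `[0, ∞)`: points `t_k ∈ [0, ∞]` with `t_0 = 0`, `t_k < t_{k+1}` whenever
`t_{k+1} < ∞`, and `t_k → ∞`. -/
structure TimePartition where
  pt : ℕ → ℝ≥0∞
  pt_zero : pt 0 = 0
  lt_succ : ∀ k, pt (k + 1) < ∞ → pt k < pt (k + 1)
  tendsto_top : Tendsto pt atTop (𝓝 ∞)

/-- The time `t_k ∧ t`. -/
noncomputable def TimePartition.cap (π : TimePartition) (t : ℝ≥0) (k : ℕ) : ℝ≥0 :=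
  (min (π.pt k) (t : ℝ≥0∞)).toNNReal

/-- The value `x_s` for `s ∈ [0, ∞]`, with the convention `x_∞ = 0`. -/
noncomputable def pathAt (x : ℝ≥0 → ℝ) (s : ℝ≥0∞) : ℝ :=
  if s = ∞ then 0 else x s.toNNReal

/-- The oscillation `O_t(x, π)` of `x` on the pieces `[t_k, t_{k+1}) ∩ [0, t]`.
(The set is nonempty, and bounded for continuous `x`.) -/
noncomputable def oscillation (x : ℝ≥0 → ℝ) (π : TimePartition) (t : ℝ≥0) : ℝ :=
  sSup {r : ℝ | ∃ (k : ℕ) (a b : ℝ≥0),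
    (π.pt k ≤ a ∧ (a : ℝ≥0∞) < π.pt (k + 1) ∧ a ≤ t) ∧
    (π.pt k ≤ b ∧ (b : ℝ≥0∞) < π.pt (k + 1) ∧ b ≤ t) ∧ r = |x b - x a|}

/-- The discrete local time
`L^π_t(u) = 2 ∑_j 1_{⟦x_{t_j ∧ t}, x_{t_{j+1} ∧ t}⟯}(u) |x_{t_{j+1} ∧ t} - u|`,
where `⟦a, b⟯` is `[a, b)` if `a ≤ b` and `[b, a)` otherwise. All but finitely many terms of the
sum vanish. -/
noncomputable def discreteLocalTime (π : TimePartition) (x : ℝ≥0 → ℝ) (t : ℝ≥0) (u : ℝ) : ℝ :=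
  2 * ∑' j : ℕ,
    (Ico (min (x (π.cap t j)) (x (π.cap t (j + 1))))
        (max (x (π.cap t j)) (x (π.cap t (j + 1))))).indicator
      (fun v : ℝ => |x (π.cap t (j + 1)) - v|) u

/-- `L` is the pathwise local time of `x` in `L¹(du)` along the sequence `P` of partitions: for
every `t`, `L^{π_n}_t → L_t` weakly in `L¹` (i.e. tested against every `h ∈ L^∞`), and `t ↦ L_t` is
continuous for the weak topology of `L¹`. -/
structure IsPathwiseLocalTime (P : ℕ → TimePartition) (x : ℝ≥0 → ℝ)
    (L : ℝ≥0 → Lp ℝ 1 (volume : Measure ℝ)) : Prop where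
  weak_tendsto : ∀ (t : ℝ≥0) (h : ℝ → ℝ), MemLp h ∞ (volume : Measure ℝ) →
    Tendsto (fun n => ∫ u, discreteLocalTime (P n) x t u * h u) atTop (𝓝 (∫ u, L t u * h u))
  weak_continuous : ∀ h : ℝ → ℝ, MemLp h ∞ (volume : Measure ℝ) →
    Continuous fun t : ℝ≥0 => ∫ u, L t u * h u

/-- The class `𝓛₁` of paths: continuous paths that possess a pathwise local time in `L¹` along the
sequence of partitions `P`, where the oscillation along `P` tends to zero. -/
structure MemLOne (P : ℕ → TimePartition) (x : ℝ≥0 → ℝ) : Prop where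
  continuous : Continuous x
  oscillation_tendsto : ∀ t : ℝ≥0, Tendsto (fun n => oscillation x (P n) t) atTop (𝓝 0)
  exists_localTime : ∃ L, IsPathwiseLocalTime P x L

/-- The Riemann sum `∑_j h(x_{t_j}) (x_{t_{j+1} ∧ t} - x_{t_j ∧ t})`. All but finitely many terms
vanish. -/
noncomputable def riemannSum (π : TimePartition) (x : ℝ≥0 → ℝ) (h : ℝ → ℝ) (t : ℝ≥0) : ℝ :=
  ∑' j : ℕ, h (pathAt x (π.pt j)) * (x (π.cap t (j + 1)) - x (π.cap t j))

/-- `I t = ∫₀ᵗ h(x_s) dx_s` is the Föllmer integral of `h` along `P`: the Riemann sums converge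
to `I`, uniformly on compacts, and `I` is continuous. -/
structure IsFollmerIntegral (P : ℕ → TimePartition) (x : ℝ≥0 → ℝ) (h : ℝ → ℝ)
    (I : ℝ≥0 → ℝ) : Prop where
  tendsto : ∀ K : Set ℝ≥0, IsCompact K →
    TendstoUniformlyOn (fun n t => riemannSum (P n) x h t) I atTop K
  continuous : Continuous I

/-- A function on `ℝ` is càdlàg: right-continuous with left limits. -/
def IsCadlag (φ : ℝ → ℝ) : Prop :=
  ∀ u, ContinuousWithinAt φ (Ici u) u ∧ ∃ l : ℝ, Tendsto φ (𝓝[<] u) (𝓝 l)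

/-- `ℓ_t(u)` is jointly continuous in `t` and càdlàg in `u`: `ℓ_s(v) → ℓ_t(u)` as
`s → t, v ↓ u`, and `ℓ_s(v)` has a limit as `s → t, v ↑ u, v < u`. -/
def IsJointlyContinuousCadlag (ℓ : ℝ≥0 → ℝ → ℝ) : Prop :=
  ∀ (t : ℝ≥0) (u : ℝ),
    Tendsto (fun p : ℝ≥0 × ℝ => ℓ p.1 p.2) (𝓝 t ×ˢ 𝓝[≥] u) (𝓝 (ℓ t u)) ∧
    ∃ l : ℝ, Tendsto (fun p : ℝ≥0 × ℝ => ℓ p.1 p.2) (𝓝 t ×ˢ 𝓝[<] u) (𝓝 l)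

/-- An admissible mollifier: `C²` on `ℝ`, nonnegative, with compact support contained in `[0, ∞)`,
and with integral one. -/
structure IsMollifier (g : ℝ → ℝ) : Prop where
  contDiff : ContDiff ℝ 2 g
  nonneg : ∀ u, 0 ≤ g u
  hasCompactSupport : HasCompactSupport g
  support_subset : tsupport g ⊆ Ici 0
  integral_eq_one : ∫ u, g u = 1

/-- The mollified function `f_n = g_n * f` with `g_n(u) = n g(n u)`. -/
noncomputable def mollify (g f : ℝ → ℝ) (n : ℕ) : ℝ → ℝ :=
  convolution (fun u : ℝ => (n : ℝ) * g (n * u)) f (ContinuousLinearMap.mul ℝ ℝ) volume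

/-- The left derivative `f'_-`. -/
noncomputable def leftDeriv (f : ℝ → ℝ) (u : ℝ) : ℝ := derivWithin f (Iio u) u

theorem leftDeriv_monotone {f : ℝ → ℝ} (hf : ConvexOn ℝ univ f) : Monotone (leftDeriv f) := by
  intro a b hab
  have h := hf.monotoneOn_leftDeriv
  rw [interior_univ] at h
  exact h (mem_univ a) (mem_univ b) hab

/-- The second derivative `f''` of a convex function `f`, as a measure: the Stieltjes measure
of the nondecreasing function `f'_-`; see `secondDeriv_Ico`. -/
noncomputable def secondDeriv (f : ℝ → ℝ) (hf : ConvexOn ℝ univ f) : Measure ℝ :=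
  (leftDeriv_monotone hf).stieltjesFunction.measure

theorem leftLim_leftDeriv {f : ℝ → ℝ} (hf : ConvexOn ℝ univ f) (a : ℝ) :
    leftLim (leftDeriv f) a = leftDeriv f a := by
  have hint : ∀ z : ℝ, z ∈ interior (univ : Set ℝ) := fun z => by simp
  have hcont : Continuous f := by
    have := hf.continuousOn_interior
    rw [interior_univ] at this
    exact continuousOn_univ.1 this
  refine le_antisymm ((leftDeriv_monotone hf).leftLim_le le_rfl) ?_
  have key : ∀ y < a, slope f a y ≤ leftLim (leftDeriv f) a := by
    intro y hy
    have ht : Tendsto (fun z => slope f y z) (𝓝[<] a) (𝓝 (slope f y a)) := by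
      have : ContinuousAt (fun z => slope f y z) a := by
        simp only [slope_def_field]
        exact (hcont.continuousAt.sub continuousAt_const).div
          (continuousAt_id.sub continuousAt_const) (sub_ne_zero.2 hy.ne')
      exact this.tendsto.mono_left nhdsWithin_le_nhds
    rw [slope_comm]
    refine le_of_tendsto ht ?_
    filter_upwards [Ioo_mem_nhdsLT hy] with z hz
    refine le_trans ?_ ((leftDeriv_monotone hf).le_leftLim hz.2)
    exact hf.slope_le_of_hasDerivWithinAt_Iio (mem_univ y) (mem_univ z) hz.1
      (hf.hasDerivWithinAt_leftDeriv_of_mem_interior (hint z))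
  have hd := hf.hasDerivWithinAt_leftDeriv_of_mem_interior (hint a)
  rw [hasDerivWithinAt_iff_tendsto_slope' (by simp)] at hd
  exact le_of_tendsto hd (eventually_nhdsWithin_of_forall fun y hy => key y hy)

/-- The characterization `f''([a, b)) = f'_-(b) - f'_-(a)`. -/
theorem secondDeriv_Ico {f : ℝ → ℝ} (hf : ConvexOn ℝ univ f) (a b : ℝ) :
    secondDeriv f hf (Ico a b) = ENNReal.ofReal (leftDeriv f b - leftDeriv f a) := by
  have h : ∀ c, leftLim (leftDeriv_monotone hf).stieltjesFunction c = leftDeriv f c := by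
    intro c
    rw [← leftLim_leftDeriv hf c]
    exact leftLim_rightLim ((leftDeriv_monotone hf).tendsto_leftLim c)
  rw [secondDeriv, StieltjesFunction.measure_Ico, h, h]

end PathwiseTanaka

/-! For convex `F` of class C², Taylor's formula with integral remainder shows that the Riemann sum
of `F'` is `F(x_t) - F(x_0)` minus a sum of Taylor remainders, and that this sum is exactly half the
integral of `F''` against the discrete local time (`riemannSum_deriv`,
`integral_discreteLocalTime_mul`). Weak L¹ convergence then gives the limit for each `t`. By
convexity the remainders are nonnegative, so their sums are nondecreasing in `t` up to a multiple of
the oscillation (`taylorSum_le_add`). Such functions converge locally uniformly when their limit is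
continuous, which yields Itô's formula for `F`.

For general convex `f`, let `γ` be the law with density `g`. Then `f_n(u)` is the `γ`-average of
`f(u - w/n)`, and `f_n''(u) du` is the image of `γ ⊗ f''` under `(w, u) ↦ u + w/n`
(`withDensity_deriv_deriv_eq_map`). The local time term thus becomes the integral of `ℓ_t(u + w/n)`
against `γ ⊗ f''`. Since `w ≥ 0`, all shifts go to the right, and right-continuity gives the limit
`ℓ_t(u)`, whatever `g` is. Dominated convergence applies because `ℓ_t` is locally bounded, by the
one-sided limits, and vanishes off the range of the path. It must vanish there everywhere and not
just a.e., as `f''` may charge Lebesgue null sets; right-continuity provides this too.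

The limit is taken with time running along a filter `𝓕`: `pure t` gives convergence for each `t`,
while `𝓝 t` gives uniformity on compacts. -/

namespace PathwiseTanaka

/-! ### Capped partition times and oscillation -/

namespace TimePartition

theorem pt_monotone (π : TimePartition) : Monotone π.pt := by
  refine monotone_nat_of_le_succ fun k => ?_
  by_cases h : π.pt (k + 1) < ∞
  · exact (π.lt_succ k h).le
  · rw [not_lt_top_iff.1 h]
    exact le_top

theorem coe_cap (π : TimePartition) (t : ℝ≥0) (k : ℕ) :
    (π.cap t k : ℝ≥0∞) = min (π.pt k) t := by
  rw [cap, ENNReal.coe_toNNReal]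
  exact ne_top_of_le_ne_top ENNReal.coe_ne_top (min_le_right _ _)

theorem cap_le (π : TimePartition) (t : ℝ≥0) (k : ℕ) : π.cap t k ≤ t := by
  rw [← ENNReal.coe_le_coe, coe_cap]
  exact min_le_right _ _

theorem coe_cap_of_pt_le (π : TimePartition) {t : ℝ≥0} {k : ℕ} (h : π.pt k ≤ t) :
    (π.cap t k : ℝ≥0∞) = π.pt k := by
  rw [coe_cap, min_eq_left h]

theorem cap_of_le_pt (π : TimePartition) {t : ℝ≥0} {k : ℕ} (h : t ≤ π.pt k) :
    π.cap t k = t := by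
  rw [← ENNReal.coe_inj, coe_cap, min_eq_right h]

theorem cap_zero (π : TimePartition) (t : ℝ≥0) : π.cap t 0 = 0 := by
  rw [← ENNReal.coe_inj, coe_cap, π.pt_zero]
  simp

theorem cap_eq_cap (π : TimePartition) {s t : ℝ≥0} {k : ℕ} (h : π.pt k ≤ s) (hst : s ≤ t) :
    π.cap s k = π.cap t k := by
  rw [← ENNReal.coe_inj, coe_cap_of_pt_le π h,
    coe_cap_of_pt_le π (h.trans (ENNReal.coe_le_coe.2 hst))]

theorem eventually_le_pt (π : TimePartition) (t : ℝ≥0) : ∀ᶠ k in atTop, (t : ℝ≥0∞) ≤ π.pt k :=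
  (π.tendsto_top.eventually (lt_mem_nhds ENNReal.coe_lt_top)).mono fun _ h => le_of_lt h

theorem exists_pt_le_lt (π : TimePartition) (s : ℝ≥0) :
    ∃ i, π.pt i ≤ s ∧ (s : ℝ≥0∞) < π.pt (i + 1) := by
  classical
  have hex : ∃ k, (s : ℝ≥0∞) < π.pt k :=
    (π.tendsto_top.eventually (lt_mem_nhds ENNReal.coe_lt_top)).exists
  have hpos : Nat.find hex ≠ 0 := by
    intro h0
    have := Nat.find_spec hex
    rw [h0, π.pt_zero] at this
    exact not_lt_bot this
  obtain ⟨i, hi⟩ := Nat.exists_eq_succ_of_ne_zero hpos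
  refine ⟨i, not_lt.1 (Nat.find_min hex (by omega)), ?_⟩
  have := Nat.find_spec hex
  rwa [hi] at this

theorem pathAt_pt (π : TimePartition) (x : ℝ≥0 → ℝ) {t : ℝ≥0} {k : ℕ} (h : π.pt k ≤ t) :
    pathAt x (π.pt k) = x (π.cap t k) := by
  rw [← π.coe_cap_of_pt_le h, pathAt, if_neg ENNReal.coe_ne_top, ENNReal.toNNReal_coe]

end TimePartition

theorem le_oscillation {x : ℝ≥0 → ℝ} (hx : Continuous x) (π : TimePartition) {T a b : ℝ≥0} {k : ℕ}
    (ha : π.pt k ≤ a ∧ (a : ℝ≥0∞) < π.pt (k + 1) ∧ a ≤ T)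
    (hb : π.pt k ≤ b ∧ (b : ℝ≥0∞) < π.pt (k + 1) ∧ b ≤ T) :
    |x b - x a| ≤ oscillation x π T := by
  obtain ⟨C, hC⟩ := (isCompact_Icc (a := (0 : ℝ≥0)) (b := T)).exists_bound_of_continuousOn
    hx.continuousOn
  refine le_csSup ⟨C + C, ?_⟩ ⟨k, a, b, ha, hb, rfl⟩
  rintro r ⟨k, a, b, ha, hb, rfl⟩
  exact (abs_sub _ _).trans (add_le_add (hC b ⟨zero_le, hb.2.2⟩) (hC a ⟨zero_le, ha.2.2⟩))

theorem oscillation_nonneg (x : ℝ≥0 → ℝ) (π : TimePartition) (T : ℝ≥0) :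
    0 ≤ oscillation x π T := by
  refine Real.sSup_nonneg ?_
  rintro r ⟨k, a, b, -, -, rfl⟩
  exact abs_nonneg _

/-! ### Taylor remainders, Riemann sums and discrete local time -/

/-- The first order Taylor remainder of `F` at `a`, evaluated at `b`. -/
noncomputable def taylorRem (F : ℝ → ℝ) (a b : ℝ) : ℝ := F b - F a - deriv F a * (b - a)

theorem taylorRem_self (F : ℝ → ℝ) (a : ℝ) : taylorRem F a a = 0 := by simp [taylorRem]

/-- Convexity gives the lower bound. The upper bound follows from it, since the remainders from `a`
to `b` and from `b` to `a` add up to `(F' b - F' a) * (b - a)`. -/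
theorem taylorRem_mem_Icc {F : ℝ → ℝ} (hF : Differentiable ℝ F) (hmono : Monotone (deriv F))
    (a b : ℝ) : taylorRem F a b ∈ Icc 0 ((deriv F b - deriv F a) * (b - a)) := by
  have hconv : ConvexOn ℝ univ F := hmono.convexOn_univ_of_deriv hF
  have key : ∀ a b, 0 ≤ taylorRem F a b := by
    intro a b
    rw [taylorRem]
    rcases lt_trichotomy a b with h | rfl | h
    · have := hconv.deriv_le_slope (mem_univ a) (mem_univ b) h (hF a)
      rw [slope_def_field, le_div_iff₀ (sub_pos.2 h)] at this
      linarith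
    · simp
    · have := hconv.slope_le_deriv (mem_univ b) (mem_univ a) h (hF a)
      rw [slope_def_field, div_le_iff₀ (sub_pos.2 h)] at this
      linarith
  refine ⟨key a b, ?_⟩
  have := key b a
  simp only [taylorRem] at *
  linarith

/-- The sum of the Taylor remainders of `F` along the partition `π`. -/
noncomputable def taylorSum (π : TimePartition) (x : ℝ≥0 → ℝ) (F : ℝ → ℝ) (t : ℝ≥0) : ℝ :=
  ∑' j : ℕ, taylorRem F (x (π.cap t j)) (x (π.cap t (j + 1)))

theorem taylorSum_eq_sum {π : TimePartition} {t : ℝ≥0} {N : ℕ} (hN : t ≤ π.pt N)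
    (x : ℝ≥0 → ℝ) (F : ℝ → ℝ) :
    taylorSum π x F t =
      ∑ j ∈ Finset.range N, taylorRem F (x (π.cap t j)) (x (π.cap t (j + 1))) := by
  refine tsum_eq_sum fun j hj => ?_
  rw [Finset.mem_range, not_lt] at hj
  rw [π.cap_of_le_pt (hN.trans (π.pt_monotone hj)),
    π.cap_of_le_pt (hN.trans (π.pt_monotone (hj.trans j.le_succ))), taylorRem_self]

theorem riemannSum_deriv (π : TimePartition) (x : ℝ≥0 → ℝ) (F : ℝ → ℝ) (t : ℝ≥0) :
    riemannSum π x (deriv F) t = F (x t) - F (x 0) - taylorSum π x F t := by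
  obtain ⟨N, hN⟩ := (π.eventually_le_pt t).exists
  rw [taylorSum_eq_sum hN, riemannSum, tsum_eq_sum (s := Finset.range N)]
  · have h1 : F (x t) - F (x 0) =
        ∑ j ∈ Finset.range N, (F (x (π.cap t (j + 1))) - F (x (π.cap t j))) := by
      rw [Finset.sum_range_sub (fun j => F (x (π.cap t j))), π.cap_of_le_pt hN, π.cap_zero]
    rw [h1, ← Finset.sum_sub_distrib]
    refine Finset.sum_congr rfl fun j _ => ?_
    -- For `t ≤ t_j` the increment is zero, so the convention for `x_∞` plays no role.
    rcases le_total (π.pt j) t with h | h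
    · rw [π.pathAt_pt x h, taylorRem]
      ring
    · rw [π.cap_of_le_pt h, π.cap_of_le_pt (h.trans (π.pt_monotone j.le_succ)), taylorRem_self]
      simp
  · intro j hj
    rw [Finset.mem_range, not_lt] at hj
    rw [π.cap_of_le_pt (hN.trans (π.pt_monotone hj)),
      π.cap_of_le_pt (hN.trans (π.pt_monotone (hj.trans j.le_succ))), sub_self, mul_zero]

theorem integral_sub_mul_deriv_deriv {F : ℝ → ℝ} (hF : ContDiff ℝ 2 F) (a b : ℝ) :
    ∫ u in a..b, (b - u) * deriv (deriv F) u = taylorRem F a b := by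
  have hF1 : ContDiff ℝ 1 (deriv F) := hF.deriv' 
  have hd : ∀ u ∈ uIcc a b,
      HasDerivAt (fun u => (b - u) * deriv F u + F u) ((b - u) * deriv (deriv F) u) u := by
    intro u _
    have h1 : HasDerivAt F (deriv F u) u := (hF.differentiable (by norm_num) u).hasDerivAt
    have h2 : HasDerivAt (deriv F) (deriv (deriv F) u) u :=
      (hF1.differentiable (by norm_num) u).hasDerivAt
    refine ((((hasDerivAt_id u).const_sub b).mul h2).add h1).congr_deriv ?_
    simp
  rw [intervalIntegral.integral_eq_sub_of_hasDerivAt hd]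
  · simp only [taylorRem]
    ring
  · exact (Continuous.mul (by fun_prop)
      (hF1.continuous_deriv le_rfl)).intervalIntegrable _ _

theorem integrable_bridge_mul {R a b : ℝ} {h : ℝ → ℝ} (ha : |a| ≤ R) (hb : |b| ≤ R)
    (hh : ContinuousOn h (Icc (-R) R)) :
    Integrable fun u => (Ico (min a b) (max a b)).indicator (fun v => |b - v|) u * h u := by
  have hsub : Icc (min a b) (max a b) ⊆ Icc (-R) R :=
    Icc_subset_Icc (le_min (abs_le.1 ha).1 (abs_le.1 hb).1) (max_le (abs_le.1 ha).2 (abs_le.1 hb).2)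
  have : (fun u => (Ico (min a b) (max a b)).indicator (fun v => |b - v|) u * h u) =
      (Ico (min a b) (max a b)).indicator fun u => |b - u| * h u := by
    ext u
    by_cases hu : u ∈ Ico (min a b) (max a b) <;> simp [hu]
  rw [this, integrable_indicator_iff measurableSet_Ico]
  refine IntegrableOn.mono_set ?_ Ico_subset_Icc_self
  exact (ContinuousOn.mul (by fun_prop) (hh.mono hsub)).integrableOn_compact isCompact_Icc

/-- On the segment between `a` and `b` the kernel `|b - u|` is the Taylor kernel `b - u` up to the
sign that the orientation of the integral absorbs. Only the values of `h` on `[-R, R]` matter, which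
later allows a bounded truncation of `F''` as test function. -/
theorem integral_bridge_mul {R a b : ℝ} {F h : ℝ → ℝ} (hF : ContDiff ℝ 2 F) (ha : |a| ≤ R)
    (hb : |b| ≤ R) (hh : EqOn h (deriv (deriv F)) (Icc (-R) R)) :
    ∫ u, (Ico (min a b) (max a b)).indicator (fun v => |b - v|) u * h u = taylorRem F a b := by
  have hsub : Icc (min a b) (max a b) ⊆ Icc (-R) R :=
    Icc_subset_Icc (le_min (abs_le.1 ha).1 (abs_le.1 hb).1) (max_le (abs_le.1 ha).2 (abs_le.1 hb).2)
  have : (fun u => (Ico (min a b) (max a b)).indicator (fun v => |b - v|) u * h u) =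
      (Ico (min a b) (max a b)).indicator fun u => |b - u| * deriv (deriv F) u := by
    ext u
    by_cases hu : u ∈ Ico (min a b) (max a b)
    · simp [hu, hh (hsub (Ico_subset_Icc_self hu))]
    · simp [hu]
  rw [this, integral_indicator measurableSet_Ico, integral_Ico_eq_integral_Ioc,
    ← integral_sub_mul_deriv_deriv hF]
  rcases le_total a b with hab | hab
  · rw [min_eq_left hab, max_eq_right hab, intervalIntegral.integral_of_le hab]
    refine setIntegral_congr_fun measurableSet_Ioc fun u hu => ?_
    simp only [abs_of_nonneg (sub_nonneg.2 hu.2)]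
  · rw [min_eq_right hab, max_eq_left hab, intervalIntegral.integral_of_ge hab, ← integral_neg]
    refine setIntegral_congr_fun measurableSet_Ioc fun u hu => ?_
    simp only [abs_of_nonpos (sub_nonpos.2 hu.1.le)]
    ring

theorem discreteLocalTime_eq_sum {π : TimePartition} {t : ℝ≥0} {N : ℕ} (hN : t ≤ π.pt N)
    (x : ℝ≥0 → ℝ) (u : ℝ) :
    discreteLocalTime π x t u = 2 * ∑ j ∈ Finset.range N,
      (Ico (min (x (π.cap t j)) (x (π.cap t (j + 1))))
        (max (x (π.cap t j)) (x (π.cap t (j + 1))))).indicator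
      (fun v : ℝ => |x (π.cap t (j + 1)) - v|) u := by
  rw [discreteLocalTime, tsum_eq_sum]
  intro j hj
  rw [Finset.mem_range, not_lt] at hj
  rw [π.cap_of_le_pt (hN.trans (π.pt_monotone hj)),
    π.cap_of_le_pt (hN.trans (π.pt_monotone (hj.trans j.le_succ)))]
  simp

theorem discreteLocalTime_eq_zero (π : TimePartition) {x : ℝ≥0 → ℝ} {t : ℝ≥0} {R u : ℝ}
    (hR : ∀ s ≤ t, |x s| ≤ R) (hu : u ∉ Icc (-R) R) : discreteLocalTime π x t u = 0 := by
  rw [discreteLocalTime, mul_eq_zero]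
  right
  convert tsum_zero with j
  refine indicator_of_notMem (fun h => hu ?_) _
  have h1 := abs_le.1 (hR _ (π.cap_le t j))
  have h2 := abs_le.1 (hR _ (π.cap_le t (j + 1)))
  exact ⟨(le_min h1.1 h2.1).trans h.1, h.2.le.trans (max_le h1.2 h2.2)⟩

theorem integral_discreteLocalTime_mul (π : TimePartition) {x : ℝ≥0 → ℝ} {t : ℝ≥0} {R : ℝ}
    {F h : ℝ → ℝ} (hF : ContDiff ℝ 2 F) (hR : ∀ s ≤ t, |x s| ≤ R)
    (hh : EqOn h (deriv (deriv F)) (Icc (-R) R)) :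
    ∫ u, discreteLocalTime π x t u * h u = 2 * taylorSum π x F t := by
  obtain ⟨N, hN⟩ := (π.eventually_le_pt t).exists
  have hc : ContinuousOn h (Icc (-R) R) :=
    ((ContDiff.deriv' hF : ContDiff ℝ 1 (deriv F)).continuous_deriv le_rfl).continuousOn.congr hh
  simp_rw [discreteLocalTime_eq_sum hN, mul_assoc, Finset.sum_mul]
  rw [integral_const_mul, integral_finsetSum, taylorSum_eq_sum hN]
  · congr 1
    exact Finset.sum_congr rfl fun j _ =>
      integral_bridge_mul hF (hR _ (π.cap_le t j)) (hR _ (π.cap_le t _)) hh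
  · exact fun j _ => integrable_bridge_mul (hR _ (π.cap_le t j)) (hR _ (π.cap_le t _)) hc

/-- Along a partition, the sum of the Taylor remainders is nondecreasing in time, up to a multiple
of the oscillation of the path. -/
theorem taylorSum_le_add {x : ℝ≥0 → ℝ} (hx : Continuous x) (π : TimePartition) {T s t : ℝ≥0}
    {R M : ℝ} {F : ℝ → ℝ} (hF : Differentiable ℝ F) (hmono : Monotone (deriv F))
    (hst : s ≤ t) (htT : t ≤ T)
    (hR : ∀ s ≤ T, |x s| ≤ R) (hM : ∀ a, |a| ≤ R → |deriv F a| ≤ M) :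
    taylorSum π x F s ≤ taylorSum π x F t + 2 * M * oscillation x π T := by
  obtain ⟨N, hN⟩ := (π.eventually_le_pt t).exists
  have hM0 : 0 ≤ M := (abs_nonneg _).trans (hM _ (hR 0 zero_le))
  have hO := oscillation_nonneg x π T
  -- Let `s ∈ [t_i, t_{i+1})`. Terms with `j < i` agree for `s` and `t`; those with `j > i` vanish
  -- for `s` and are nonnegative for `t`. Only `j = i` costs an error, at most `(M + M)` times the
  -- oscillation.
  obtain ⟨i, hi1, hi2⟩ := π.exists_pt_le_lt s
  rw [taylorSum_eq_sum hN, taylorSum_eq_sum ((ENNReal.coe_le_coe.2 hst).trans hN)]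
  have hterm : ∀ j ∈ Finset.range N,
      taylorRem F (x (π.cap s j)) (x (π.cap s (j + 1))) ≤
      taylorRem F (x (π.cap t j)) (x (π.cap t (j + 1))) +
        if j = i then 2 * M * oscillation x π T else 0 := by
    intro j _
    have hnn := (taylorRem_mem_Icc hF hmono (x (π.cap t j)) (x (π.cap t (j + 1)))).1
    rcases lt_trichotomy j i with h | rfl | h
    · rw [if_neg h.ne, add_zero, π.cap_eq_cap ((π.pt_monotone h.le).trans hi1) hst,
        π.cap_eq_cap ((π.pt_monotone (Nat.succ_le_of_lt h)).trans hi1) hst]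
    · rw [if_pos rfl, π.cap_of_le_pt hi2.le]
      have hcap : π.cap s j ≤ s := π.cap_le s j
      have hosc : |x s - x (π.cap s j)| ≤ oscillation x π T := by
        refine le_oscillation hx π (k := j) ⟨?_, ?_, hcap.trans (hst.trans htT)⟩
          ⟨hi1, hi2, hst.trans htT⟩
        · rw [π.coe_cap_of_pt_le hi1]
        · exact (ENNReal.coe_le_coe.2 hcap).trans_lt hi2
      have h1 := (taylorRem_mem_Icc hF hmono (x (π.cap s j)) (x s)).2
      have h2 : |deriv F (x s) - deriv F (x (π.cap s j))| ≤ M + M :=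
        (abs_sub _ _).trans (add_le_add (hM _ (hR _ (hst.trans htT)))
          (hM _ (hR _ (hcap.trans (hst.trans htT)))))
      have h3 := le_abs_self ((deriv F (x s) - deriv F (x (π.cap s j))) * (x s - x (π.cap s j)))
      rw [abs_mul] at h3
      have h4 := mul_le_mul h2 hosc (abs_nonneg _) (by positivity)
      linarith
    · have : (s : ℝ≥0∞) ≤ π.pt j := hi2.le.trans (π.pt_monotone h)
      rw [if_neg h.ne', π.cap_of_le_pt this,
        π.cap_of_le_pt (this.trans (π.pt_monotone j.le_succ)), taylorRem_self, add_zero]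
      exact hnn
  refine (Finset.sum_le_sum hterm).trans ?_
  rw [Finset.sum_add_distrib, Finset.sum_ite_eq']
  gcongr
  split_ifs
  · exact le_rfl
  · positivity

/-! ### From pointwise to locally uniform convergence -/

/-- Pointwise convergence of asymptotically nondecreasing functions to a continuous limit is
continuous convergence. -/
theorem tendsto_prod_nhds_of_almost_monotone {φ : ℕ → ℝ≥0 → ℝ} {ψ : ℝ≥0 → ℝ} {ε : ℕ → ℝ} {t T : ℝ≥0}
    (htT : t < T) (hφ : ∀ n s s', s ≤ s' → s' ≤ T → φ n s ≤ φ n s' + ε n)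
    (hε : Tendsto ε atTop (𝓝 0)) (hlim : ∀ s ≤ T, Tendsto (fun n => φ n s) atTop (𝓝 (ψ s)))
    (hψ : ContinuousAt ψ t) :
    Tendsto (fun p : ℕ × ℝ≥0 => φ p.1 p.2) (atTop ×ˢ 𝓝 t) (𝓝 (ψ t)) := by
  rw [Metric.tendsto_nhds]
  intro δ hδ
  have hU : {s | dist (ψ s) (ψ t) < δ / 3} ∩ Iio T ∈ 𝓝 t :=
    inter_mem (Metric.tendsto_nhds.1 hψ _ (by positivity)) (Iio_mem_nhds htT)
  -- Near `t`, almost monotonicity traps `φ n` between its values at `a` and `b`. The three errors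
  -- of `δ / 3` are convergence at an endpoint, variation of `ψ`, and `ε n`.
  obtain ⟨a, b, htab, hnhds, hsub⟩ := exists_Icc_mem_subset_of_mem_nhds hU
  have hab := htab.1.trans htab.2
  have ha := hsub (left_mem_Icc.2 hab)
  have hb := hsub (right_mem_Icc.2 hab)
  have hna := Metric.tendsto_nhds.1 (hlim a (le_of_lt ha.2)) (δ / 3) (by positivity)
  have hnb := Metric.tendsto_nhds.1 (hlim b (le_of_lt hb.2)) (δ / 3) (by positivity)
  have hne := Metric.tendsto_nhds.1 hε (δ / 3) (by positivity)
  filter_upwards [prod_mem_prod (hna.and (hnb.and hne)) hnhds] with p hp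
  obtain ⟨⟨h1, h2, h3⟩, h4⟩ := hp
  have h5 := hφ p.1 a p.2 h4.1 ((hsub h4).2.le)
  have h6 := hφ p.1 p.2 b h4.2 (le_of_lt hb.2)
  have ha' : dist (ψ a) (ψ t) < δ / 3 := ha.1
  have hb' : dist (ψ b) (ψ t) < δ / 3 := hb.1
  simp only [Real.dist_eq, abs_lt] at *
  constructor <;> linarith [h1.1, h1.2, h2.1, h2.2, h3.1, h3.2, ha'.1, ha'.2, hb'.1, hb'.2]

theorem tendstoUniformlyOn_of_tendsto_prod_nhds {φ : ℕ → ℝ≥0 → ℝ} {ψ : ℝ≥0 → ℝ}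
    (hψ : Continuous ψ)
    (h : ∀ t, Tendsto (fun p : ℕ × ℝ≥0 => φ p.1 p.2) (atTop ×ˢ 𝓝 t) (𝓝 (ψ t)))
    {K : Set ℝ≥0} (hK : IsCompact K) : TendstoUniformlyOn φ ψ atTop K := by
  rw [← tendstoLocallyUniformlyOn_iff_tendstoUniformlyOn_of_compact hK,
    tendstoLocallyUniformlyOn_iff_forall_tendsto]
  intro t _
  have h1 : Tendsto (fun p : ℕ × ℝ≥0 => ψ p.2) (atTop ×ˢ 𝓝 t) (𝓝 (ψ t)) :=
    hψ.continuousAt.tendsto.comp tendsto_snd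
  exact ((h1.prodMk_nhds (h t)).mono_right (nhds_le_uniformity (ψ t))).mono_left
    (prod_mono le_rfl nhdsWithin_le_nhds)

theorem exists_bound_path {x : ℝ≥0 → ℝ} (hx : Continuous x) (T : ℝ≥0) :
    ∃ R, ∀ s ≤ T, |x s| ≤ R := by
  obtain ⟨C, hC⟩ := (isCompact_Icc (a := (0 : ℝ≥0)) (b := T)).exists_bound_of_continuousOn
    hx.continuousOn
  exact ⟨C, fun s hs => hC s ⟨zero_le, hs⟩⟩

/-! ### Support of the local time and Itô's formula for C² functions -/

/-- The pathwise local time at time `t` vanishes off the range of the path on `[0, t]`. -/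
theorem IsPathwiseLocalTime.ae_eq_zero {P : ℕ → TimePartition} {x : ℝ≥0 → ℝ}
    {L : ℝ≥0 → Lp ℝ 1 (volume : Measure ℝ)} (hL : IsPathwiseLocalTime P x L) {t : ℝ≥0} {R : ℝ}
    (hR : ∀ s ≤ t, |x s| ≤ R) : ∀ᵐ u, u ∉ Icc (-R) R → L t u = 0 := by
  have hmeas : Measurable (L t) := (Lp.stronglyMeasurable (L t)).measurable
  -- Testing against the sign of `L t` off the interval turns the limit into the integral of `|L t|`
  -- there, while every discrete pairing is zero.
  let h : ℝ → ℝ := (Icc (-R) R)ᶜ.indicator fun u => if 0 ≤ L t u then 1 else -1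
  have hh : MemLp h ∞ (volume : Measure ℝ) := by
    refine memLp_top_of_bound ?_ 1 (Eventually.of_forall fun u => ?_)
    · exact ((Measurable.ite (measurableSet_le measurable_const hmeas) measurable_const
        measurable_const).indicator measurableSet_Icc.compl).aestronglyMeasurable
    · refine (norm_indicator_le_norm_self _ _).trans ?_
      split_ifs <;> simp
  have h0 := hL.weak_tendsto t h hh
  have hz : ∀ n u, discreteLocalTime (P n) x t u * h u = 0 := by
    intro n u
    by_cases hu : u ∈ Icc (-R) R
    · simp [h, hu]
    · rw [discreteLocalTime_eq_zero (P n) hR hu, zero_mul]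
  simp only [hz, integral_zero] at h0
  have h1 : ∫ u, L t u * h u = 0 := (tendsto_nhds_unique h0 tendsto_const_nhds)
  have h2 : (fun u => L t u * h u) = (Icc (-R) R)ᶜ.indicator fun u => |L t u| := by
    ext u
    by_cases hu : u ∈ Icc (-R) R
    · simp [h, hu]
    · have : u ∈ (Icc (-R) R)ᶜ := hu
      simp only [h, indicator_of_mem this]
      split_ifs with h0
      · rw [mul_one, abs_of_nonneg h0]
      · rw [mul_neg_one, abs_of_neg (not_le.1 h0)]
  have hint : Integrable (L t) := L1.integrable_coeFn (L t)
  rw [h2, integral_eq_zero_iff_of_nonneg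
    (fun u => indicator_nonneg (fun _ _ => abs_nonneg _) u)
    (hint.abs.indicator measurableSet_Icc.compl)] at h1
  filter_upwards [h1] with u hu hmem
  have : u ∈ (Icc (-R) R)ᶜ := hmem
  simpa [indicator_of_mem this] using hu

/-- A right-continuous function that vanishes a.e. off a compact interval vanishes everywhere off
this interval. -/
theorem eq_zero_of_ae_eq_zero_off_Icc {φ : ℝ → ℝ} (hφ : ∀ u, ContinuousWithinAt φ (Ici u) u) {a b : ℝ}
    (h : ∀ᵐ u, u ∉ Icc a b → φ u = 0) {u : ℝ} (hu : u ∉ Icc a b) : φ u = 0 := by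
  by_contra hne
  -- A nonzero value would persist on some `[u, c)`, a set of positive measure.
  have h1 : ∀ᶠ v in 𝓝[≥] u, φ v ≠ 0 ∧ v ∉ Icc a b :=
    ((hφ u).eventually_ne hne).and
      (nhdsWithin_le_nhds (isClosed_Icc.isOpen_compl.mem_nhds hu))
  obtain ⟨c, hc, hsub⟩ := mem_nhdsGE_iff_exists_Ico_subset.1 h1
  have h2 : volume (Ico u c) = 0 :=
    measure_mono_null (t := {v | ¬(v ∉ Icc a b → φ v = 0)})
      (fun v hv hv0 => (hsub hv).1 (hv0 (hsub hv).2)) h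
  rw [Real.volume_Ico, ENNReal.ofReal_eq_zero] at h2
  exact absurd (mem_Ioi.1 hc) (by linarith)

/-- The Föllmer integral of the derivative of a convex `C²` function: Itô's formula with local
time. -/
theorem IsPathwiseLocalTime.isFollmerIntegral_deriv {P : ℕ → TimePartition} {x : ℝ≥0 → ℝ}
    (hx : Continuous x) (hosc : ∀ t, Tendsto (fun n => oscillation x (P n) t) atTop (𝓝 0))
    {L : ℝ≥0 → Lp ℝ 1 (volume : Measure ℝ)} (hL : IsPathwiseLocalTime P x L)
    {F : ℝ → ℝ} (hF : ContDiff ℝ 2 F) (hmono : Monotone (deriv F)) :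
    IsFollmerIntegral P x (deriv F)
      fun t => F (x t) - F (x 0) - 1 / 2 * ∫ u, L t u * deriv (deriv F) u := by
  have hF1 : ContDiff ℝ 1 (deriv F) := hF.deriv'
  have hF2 : Continuous (deriv (deriv F)) := hF1.continuous_deriv le_rfl
  have hdiff : Differentiable ℝ F := hF.differentiable (by norm_num)
  let A : ℝ≥0 → ℝ := fun t => ∫ u, L t u * deriv (deriv F) u
  have key : ∀ t, ContinuousAt A t ∧
      Tendsto (fun p : ℕ × ℝ≥0 => taylorSum (P p.1) x F p.2) (atTop ×ˢ 𝓝 t)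
        (𝓝 (1 / 2 * A t)) := by
    intro t
    -- A horizon beyond `t` gives one range bound, hence one test function, for all times near `t`.
    obtain ⟨T, htT⟩ : ∃ T, t < T := ⟨t + 1, lt_add_of_pos_right t one_pos⟩
    obtain ⟨R, hR⟩ := exists_bound_path hx T
    obtain ⟨M, hM⟩ := (isCompact_Icc (a := -R) (b := R)).exists_bound_of_continuousOn
      hF1.continuous.continuousOn
    obtain ⟨B, hB⟩ := (isCompact_Icc (a := -R) (b := R)).exists_bound_of_continuousOn
      hF2.continuousOn
    -- `F''` need not be bounded; truncating it to a range of the path makes it an L^∞ test function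
    -- and changes no integral up to time `T`.
    let h : ℝ → ℝ := (Icc (-R) R).indicator (deriv (deriv F))
    have hh : MemLp h ∞ (volume : Measure ℝ) := by
      refine memLp_top_of_bound
        (hF2.measurable.indicator measurableSet_Icc).aestronglyMeasurable (max B 0)
        (Eventually.of_forall fun u => ?_)
      by_cases hu : u ∈ Icc (-R) R
      · simp only [h, indicator_of_mem hu]
        exact (hB u hu).trans (le_max_left _ _)
      · simp [h, hu]
    have heq : EqOn h (deriv (deriv F)) (Icc (-R) R) := fun u hu => indicator_of_mem hu _
    have hA : ∀ s ≤ T, A s = ∫ u, L s u * h u := by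
      intro s hs
      refine integral_congr_ae ?_
      filter_upwards [hL.ae_eq_zero fun r hr => hR r (hr.trans hs)] with u hu
      by_cases hmem : u ∈ Icc (-R) R
      · rw [heq hmem]
      · rw [hu hmem, zero_mul, zero_mul]
    have hcont : ContinuousAt A t := by
      refine (hL.weak_continuous h hh).continuousAt.congr ?_
      filter_upwards [Iio_mem_nhds htT] with s hs
      exact (hA s (le_of_lt hs)).symm
    refine ⟨hcont, ?_⟩
    refine tendsto_prod_nhds_of_almost_monotone (ψ := fun s => 1 / 2 * A s)
      (φ := fun n => taylorSum (P n) x F) (ε := fun n => 2 * M * oscillation x (P n) T) htT ?_ ?_ ?_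
      (continuousAt_const.mul hcont)
    · intro n s s' hs hs'
      exact taylorSum_le_add hx (P n) hdiff hmono hs hs' hR fun a ha => hM a (abs_le.1 ha)
    · simpa using (hosc T).const_mul (2 * M)
    · intro s hs
      have h1 := (hL.weak_tendsto s h hh).const_mul (1 / 2)
      simp only [integral_discreteLocalTime_mul _ hF (fun r hr => hR r (hr.trans hs)) heq] at h1
      rw [hA s hs]
      refine h1.congr fun n => ?_
      ring
  have hc : Continuous fun t => F (x t) - F (x 0) - 1 / 2 * A t :=
    ((hF.continuous.comp hx).sub continuous_const).sub
      (continuous_const.mul (continuous_iff_continuousAt.2 fun t => (key t).1))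
  refine ⟨fun K hK => tendstoUniformlyOn_of_tendsto_prod_nhds hc (fun t => ?_) hK, hc⟩
  simp only [riemannSum_deriv]
  refine Tendsto.sub (Tendsto.sub ?_ tendsto_const_nhds) (key t).2
  exact (hF.continuous.comp hx).continuousAt.tendsto.comp tendsto_snd

/-! ### Mollifiers as probability measures -/

/-- The measure with density `g`. -/
noncomputable def densityMeasure (g : ℝ → ℝ) : Measure ℝ :=
  volume.withDensity fun u => ENNReal.ofReal (g u)

namespace IsMollifier

variable {g : ℝ → ℝ}

theorem continuous (hg : IsMollifier g) : Continuous g := hg.contDiff.continuous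

theorem isProbabilityMeasure (hg : IsMollifier g) : IsProbabilityMeasure (densityMeasure g) := by
  refine ⟨?_⟩
  rw [densityMeasure, withDensity_apply _ MeasurableSet.univ, Measure.restrict_univ,
    ← ofReal_integral_eq_lintegral_ofReal
      (hg.continuous.integrable_of_hasCompactSupport hg.hasCompactSupport)
      (Eventually.of_forall hg.nonneg), hg.integral_eq_one, ENNReal.ofReal_one]

theorem exists_ae_mem_Icc (hg : IsMollifier g) :
    ∃ S, 0 ≤ S ∧ ∀ᵐ w ∂(densityMeasure g), w ∈ Icc 0 S := by
  obtain ⟨S, hS⟩ := hg.hasCompactSupport.isCompact.isBounded.subset_closedBall 0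
  refine ⟨max S 0, le_max_right _ _, ?_⟩
  rw [densityMeasure, ae_withDensity_iff (hg.continuous.measurable.ennreal_ofReal)]
  refine Eventually.of_forall fun w hw => ?_
  have hmem : w ∈ tsupport g := subset_tsupport g fun h0 => hw (by simp [h0])
  have h1 := hS hmem
  rw [Metric.mem_closedBall, dist_zero_right, Real.norm_eq_abs] at h1
  exact ⟨hg.support_subset hmem, (le_abs_self w).trans (h1.trans (le_max_left _ _))⟩

theorem integral_densityMeasure (hg : IsMollifier g) (φ : ℝ → ℝ) :
    ∫ w, φ w ∂(densityMeasure g) = ∫ w, g w * φ w := by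
  rw [densityMeasure, integral_withDensity_eq_integral_toReal_smul
    hg.continuous.measurable.ennreal_ofReal (Eventually.of_forall fun _ => ENNReal.ofReal_lt_top)]
  simp only [ENNReal.toReal_ofReal (hg.nonneg _), smul_eq_mul]

/-- Substituting `w = n u` fixes the averaging measure and leaves `n` only in the shift. For `n = 0`
the left side is `0` but the right side is `f u`. -/
theorem mollify_apply (hg : IsMollifier g) (f : ℝ → ℝ) {n : ℕ} (hn : n ≠ 0) (u : ℝ) :
    mollify g f n u = ∫ w, f (u - (n : ℝ)⁻¹ * w) ∂(densityMeasure g) := by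
  have hn' : (n : ℝ) ≠ 0 := Nat.cast_ne_zero.2 hn
  have h := Measure.integral_comp_mul_left (fun w => g w * f (u - (n : ℝ)⁻¹ * w)) (n : ℝ)
  rw [hg.integral_densityMeasure]
  simp only [inv_mul_cancel_left₀ hn', smul_eq_mul] at h
  rw [mollify, convolution_def]
  simp only [ContinuousLinearMap.mul_apply', mul_assoc]
  rw [integral_const_mul, h, abs_of_nonneg (by positivity), mul_inv_cancel_left₀ hn']

theorem contDiff_mollify (hg : IsMollifier g) {f : ℝ → ℝ} (hf : Continuous f) (n : ℕ) :
    ContDiff ℝ 2 (mollify g f n) := by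
  rcases eq_or_ne n 0 with rfl | hn
  · have : mollify g f 0 = fun _ => 0 := by
      ext u
      simp [mollify, convolution_def]
    rw [this]
    exact contDiff_const
  · have hs : HasCompactSupport fun u : ℝ => (n : ℝ) * g (n * u) :=
      (hg.hasCompactSupport.comp_homeomorph
        (Homeomorph.mulLeft₀ (n : ℝ) (Nat.cast_ne_zero.2 hn))).mul_left
    exact hs.contDiff_convolution_left (n := 2) (ContinuousLinearMap.mul ℝ ℝ)
      (contDiff_const.mul (hg.contDiff.comp (contDiff_const.mul contDiff_id)))
      hf.locallyIntegrable

end IsMollifier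

/-! ### Derivatives of smoothed convex functions -/

theorem continuous_of_convexOn_univ {f : ℝ → ℝ} (hf : ConvexOn ℝ univ f) : Continuous f := by
  have := hf.continuousOn_interior
  rw [interior_univ] at this
  exact continuousOn_univ.1 this

/-- These bounds dominate the difference quotients in `deriv_eq_integral_leftDeriv`. -/
theorem slope_mem_Icc_leftDeriv {f : ℝ → ℝ} (hf : ConvexOn ℝ univ f) {y z : ℝ} (hyz : y < z) :
    slope f y z ∈ Icc (leftDeriv f y) (leftDeriv f z) := by
  have hint : ∀ z : ℝ, z ∈ interior (univ : Set ℝ) := fun z => by simp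
  exact ⟨(hf.leftDeriv_le_rightDeriv_of_mem_interior (hint y)).trans
    (hf.rightDeriv_le_slope_of_mem_interior (hint y) (mem_univ z) hyz),
    hf.slope_le_leftDeriv_of_mem_interior (mem_univ y) (hint z) hyz⟩

theorem integrable_comp_sub_mul_of_monotone {γ : Measure ℝ} [IsFiniteMeasure γ] {S θ : ℝ}
    (hγ : ∀ᵐ w ∂γ, w ∈ Icc 0 S) (hθ : 0 ≤ θ) {m : ℝ → ℝ} (hm : Monotone m) (u : ℝ) :
    Integrable (fun w => m (u - θ * w)) γ := by
  refine Integrable.of_bound (C := max |m (u - θ * S)| |m u|)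
    (hm.measurable.comp (by fun_prop)).aestronglyMeasurable ?_
  filter_upwards [hγ] with w hw
  have h1 : m (u - θ * S) ≤ m (u - θ * w) := hm (by nlinarith [hw.2])
  have h2 : m (u - θ * w) ≤ m u := hm (by nlinarith [hw.1])
  exact abs_le_max_abs_abs h1 h2

theorem integrable_comp_sub_mul_of_continuous {γ : Measure ℝ} [IsFiniteMeasure γ] {S θ : ℝ}
    (hγ : ∀ᵐ w ∂γ, w ∈ Icc 0 S) {f : ℝ → ℝ} (hf : Continuous f) (u : ℝ) :
    Integrable (fun w => f (u - θ * w)) γ := by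
  have hc : Continuous fun w => f (u - θ * w) := hf.comp (by fun_prop)
  obtain ⟨C, hC⟩ := (isCompact_Icc (a := (0 : ℝ)) (b := S)).exists_bound_of_continuousOn
    hc.continuousOn
  exact Integrable.of_bound hc.aestronglyMeasurable C (hγ.mono fun w hw => hC w hw)

/-- The derivative of a smoothing of a convex function is the smoothing of its left derivative. -/
theorem deriv_eq_integral_leftDeriv {f : ℝ → ℝ} (hf : ConvexOn ℝ univ f) {γ : Measure ℝ}
    [IsFiniteMeasure γ] {S θ : ℝ} (hγ : ∀ᵐ w ∂γ, w ∈ Icc 0 S) (hθ : 0 ≤ θ) {F : ℝ → ℝ}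
    (hF : ∀ u, F u = ∫ w, f (u - θ * w) ∂γ) {u : ℝ} (hd : DifferentiableAt ℝ F u) :
    deriv F u = ∫ w, leftDeriv f (u - θ * w) ∂γ := by
  have hcont := continuous_of_convexOn_univ hf
  have hmono := leftDeriv_monotone hf
  -- As `F` is differentiable at `u`, quotients from the left suffice, and under the integral these
  -- tend to left derivatives of `f`.
  have h1 : Tendsto (slope F u) (𝓝[<] u) (𝓝 (deriv F u)) :=
    (hasDerivWithinAt_iff_tendsto_slope' (by simp)).1 hd.hasDerivAt.hasDerivWithinAt
  refine tendsto_nhds_unique h1 ?_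
  have h2 : ∀ z, slope F u z = ∫ w, slope f (u - θ * w) (z - θ * w) ∂γ := by
    intro z
    simp only [slope_def_field, hF, sub_sub_sub_cancel_right]
    rw [integral_div, integral_sub (integrable_comp_sub_mul_of_continuous hγ hcont z)
      (integrable_comp_sub_mul_of_continuous hγ hcont u)]
  simp only [funext h2]
  refine tendsto_integral_filter_of_dominated_convergence
    (fun _ => max |leftDeriv f (u - 1 - θ * S)| |leftDeriv f u|) ?_ ?_ (integrable_const _) ?_
  · refine Eventually.of_forall fun z => Continuous.aestronglyMeasurable ?_
    simp only [slope_def_field, sub_sub_sub_cancel_right]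
    exact ((hcont.comp (by fun_prop)).sub (hcont.comp (by fun_prop))).div_const _
  · filter_upwards [Ioo_mem_nhdsLT (show u - 1 < u by linarith)] with z hz
    filter_upwards [hγ] with w hw
    have h3 := slope_mem_Icc_leftDeriv hf (show z - θ * w < u - θ * w by linarith [hz.2])
    rw [slope_comm] at h3
    refine abs_le_max_abs_abs (le_trans (hmono ?_) h3.1) (h3.2.trans (hmono ?_))
    · nlinarith [hw.2, hz.1]
    · nlinarith [hw.1]
  · refine Eventually.of_forall fun w => ?_
    have h4 := hf.hasDerivWithinAt_leftDeriv_of_mem_interior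
      (show u - θ * w ∈ interior univ by simp)
    rw [hasDerivWithinAt_iff_tendsto_slope' (by simp)] at h4
    refine h4.comp (tendsto_nhdsWithin_iff.2 ⟨?_, ?_⟩)
    · exact tendsto_nhdsWithin_of_tendsto_nhds
        ((continuous_id.sub continuous_const).tendsto u)
    · filter_upwards [self_mem_nhdsWithin] with z hz
      exact sub_lt_sub_right (mem_Iio.1 hz) _

theorem monotone_integral_comp_sub_mul {γ : Measure ℝ} [IsFiniteMeasure γ] {S θ : ℝ}
    (hγ : ∀ᵐ w ∂γ, w ∈ Icc 0 S) (hθ : 0 ≤ θ) {m : ℝ → ℝ} (hm : Monotone m) :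
    Monotone fun u => ∫ w, m (u - θ * w) ∂γ := fun a b hab =>
  integral_mono (integrable_comp_sub_mul_of_monotone hγ hθ hm a)
    (integrable_comp_sub_mul_of_monotone hγ hθ hm b) fun w => hm (by linarith)

instance (f : ℝ → ℝ) (hf : ConvexOn ℝ univ f) : IsLocallyFiniteMeasure (secondDeriv f hf) := by
  unfold secondDeriv
  infer_instance

instance (f : ℝ → ℝ) (hf : ConvexOn ℝ univ f) : SigmaFinite (secondDeriv f hf) := by
  unfold secondDeriv
  infer_instance

/-- The second derivative of a smoothing of a convex function `f` is the density of the smoothing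
of the measure `f''`. -/
theorem withDensity_deriv_deriv_eq_map {f : ℝ → ℝ} (hf : ConvexOn ℝ univ f) {γ : Measure ℝ}
    [IsFiniteMeasure γ] {S θ : ℝ} (hγ : ∀ᵐ w ∂γ, w ∈ Icc 0 S) (hθ : 0 ≤ θ) {F : ℝ → ℝ}
    (hF : ContDiff ℝ 2 F) (hF' : ∀ u, deriv F u = ∫ w, leftDeriv f (u - θ * w) ∂γ) :
    (volume.withDensity fun u => ENNReal.ofReal (deriv (deriv F) u)) =
      (γ.prod (secondDeriv f hf)).map fun p => p.2 + θ * p.1 := by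
  have hF1 : ContDiff ℝ 1 (deriv F) := hF.deriv'
  have hF2 : Continuous (deriv (deriv F)) := hF1.continuous_deriv le_rfl
  have hmono := leftDeriv_monotone hf
  have hFmono : Monotone (deriv F) := by
    rw [funext hF']
    exact monotone_integral_comp_sub_mul hγ hθ hmono
  have hnn : ∀ u, 0 ≤ deriv (deriv F) u := fun u => hFmono.deriv_nonneg
  have : IsLocallyFiniteMeasure
      (volume.withDensity fun u => ENNReal.ofReal (deriv (deriv F) u)) :=
    IsLocallyFiniteMeasure.withDensity_ofReal hF2
  -- On `[a, b)` both measures have mass `F' b - F' a`: on the right, the section at `w` is `[a - θ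
  -- w, b - θ w)`, of `f''`-mass given by `secondDeriv_Ico`.
  refine Measure.ext_of_Ico _ _ fun a b hab => ?_
  have hm : Measurable fun p : ℝ × ℝ => p.2 + θ * p.1 := by fun_prop
  rw [withDensity_apply _ measurableSet_Ico, Measure.map_apply hm measurableSet_Ico,
    Measure.prod_apply (hm measurableSet_Ico),
    ← ofReal_integral_eq_lintegral_ofReal
      ((hF2.continuousOn.integrableOn_compact isCompact_Icc).mono_set Ico_subset_Icc_self)
      (Eventually.of_forall hnn), integral_Ico_eq_integral_Ioc,
    ← intervalIntegral.integral_of_le hab.le,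
    intervalIntegral.integral_deriv_eq_sub
      (fun u _ => hF1.differentiable (by norm_num) u) (hF2.intervalIntegrable _ _), hF', hF',
    ← integral_sub (integrable_comp_sub_mul_of_monotone hγ hθ hmono b)
      (integrable_comp_sub_mul_of_monotone hγ hθ hmono a)]
  have hint : Integrable (fun w => leftDeriv f (b - θ * w) - leftDeriv f (a - θ * w)) γ :=
    (integrable_comp_sub_mul_of_monotone hγ hθ hmono b).sub
      (integrable_comp_sub_mul_of_monotone hγ hθ hmono a)
  rw [ofReal_integral_eq_lintegral_ofReal hint
    (Eventually.of_forall fun w => sub_nonneg.2 (hmono (by linarith)))]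
  refine lintegral_congr fun w => ?_
  rw [← secondDeriv_Ico hf]
  congr 1
  ext v
  simp only [mem_Ico, mem_preimage, sub_le_iff_le_add, lt_sub_iff_add_lt]

theorem integral_mul_deriv_deriv {f : ℝ → ℝ} (hf : ConvexOn ℝ univ f) {γ : Measure ℝ}
    [IsFiniteMeasure γ] {S θ : ℝ} (hγ : ∀ᵐ w ∂γ, w ∈ Icc 0 S) (hθ : 0 ≤ θ) {F : ℝ → ℝ}
    (hF : ContDiff ℝ 2 F) (hF' : ∀ u, deriv F u = ∫ w, leftDeriv f (u - θ * w) ∂γ)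
    {φ : ℝ → ℝ} (hφ : Measurable φ) :
    ∫ u, φ u * deriv (deriv F) u =
      ∫ p, φ (p.2 + θ * p.1) ∂(γ.prod (secondDeriv f hf)) := by
  have hF1 : ContDiff ℝ 1 (deriv F) := hF.deriv'
  have hF2 : Continuous (deriv (deriv F)) := hF1.continuous_deriv le_rfl
  have hFmono : Monotone (deriv F) := by
    rw [funext hF']
    exact monotone_integral_comp_sub_mul hγ hθ (leftDeriv_monotone hf)
  rw [← integral_map (f := φ) (φ := fun p : ℝ × ℝ => p.2 + θ * p.1) (by fun_prop)
    hφ.aestronglyMeasurable, ← withDensity_deriv_deriv_eq_map hf hγ hθ hF hF',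
    integral_withDensity_eq_integral_toReal_smul hF2.measurable.ennreal_ofReal
      (Eventually.of_forall fun _ => ENNReal.ofReal_lt_top)]
  refine integral_congr_ae (Eventually.of_forall fun u => ?_)
  simp only [ENNReal.toReal_ofReal (hFmono.deriv_nonneg (x := u)), smul_eq_mul, mul_comm]

/-! ### Càdlàg functions and limits under right shifts -/

/-- Rounding `u` up to the grid of step `1 / (n + 1)` approaches `u` from the right, and `φ` after
rounding factors through `ℤ`. -/
theorem measurable_of_continuousWithinAt_Ici {φ : ℝ → ℝ}
    (hφ : ∀ u, ContinuousWithinAt φ (Ici u) u) : Measurable φ := by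
  let r : ℕ → ℝ → ℝ := fun n u => (⌈((n : ℝ) + 1) * u⌉ : ℝ) / ((n : ℝ) + 1)
  have hr : ∀ u, Tendsto (fun n => r n u) atTop (𝓝[≥] u) := by
    intro u
    refine tendsto_nhdsWithin_iff.2 ⟨?_, Eventually.of_forall fun n => ?_⟩
    · refine tendsto_of_tendsto_of_tendsto_of_le_of_le (tendsto_const_nhds (x := u))
        (h := fun n : ℕ => u + 1 / ((n : ℝ) + 1)) ?_ (fun n => ?_) (fun n => ?_)
      · simpa using (tendsto_const_nhds (x := u)).add tendsto_one_div_add_atTop_nhds_zero_nat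
      · have : (0 : ℝ) < n + 1 := by positivity
        simp only [r, le_div_iff₀ this]
        linarith [Int.le_ceil (((n : ℝ) + 1) * u)]
      · have : (0 : ℝ) < n + 1 := by positivity
        have h1 : (u + 1 / ((n : ℝ) + 1)) * (n + 1) = (n + 1) * u + 1 := by field_simp
        simp only [r, div_le_iff₀ this, h1]
        linarith [(Int.ceil_lt_add_one (((n : ℝ) + 1) * u)).le]
    · have : (0 : ℝ) < n + 1 := by positivity
      simp only [r, mem_Ici, le_div_iff₀ this]
      linarith [Int.le_ceil (((n : ℝ) + 1) * u)]
  refine measurable_of_tendsto_metrizable (f := fun n u => φ (r n u)) (fun n => ?_)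
    (tendsto_pi_nhds.2 fun u => (hφ u).tendsto.comp (hr u))
  exact (measurable_from_top (f := fun k : ℤ => φ ((k : ℝ) / ((n : ℝ) + 1)))).comp
    (Int.measurable_ceil.comp (measurable_const.mul measurable_id))

/-- `ℓ_s(v)` tends to `ℓ_t(u)` as `s → t` along `𝓕` and `v ↓ u`, and has a limit as `s → t` along
`𝓕` and `v ↑ u`, for all `u`. -/
def IsCadlagAlong (ℓ : ℝ≥0 → ℝ → ℝ) (t : ℝ≥0) (𝓕 : Filter ℝ≥0) : Prop :=
  ∀ u : ℝ,
    Tendsto (fun p : ℝ≥0 × ℝ => ℓ p.1 p.2) (𝓕 ×ˢ 𝓝[≥] u) (𝓝 (ℓ t u)) ∧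
    ∃ l : ℝ, Tendsto (fun p : ℝ≥0 × ℝ => ℓ p.1 p.2) (𝓕 ×ˢ 𝓝[<] u) (𝓝 l)

theorem isCadlagAlong_pure {ℓ : ℝ≥0 → ℝ → ℝ} {t : ℝ≥0} (h : IsCadlag (ℓ t)) :
    IsCadlagAlong ℓ t (pure t) := by
  intro u
  obtain ⟨h1, l, h2⟩ := h u
  refine ⟨?_, l, ?_⟩
  · rw [pure_prod, tendsto_map'_iff]
    exact h1
  · rw [pure_prod, tendsto_map'_iff]
    exact h2

/-- The two one-sided limits bound `ℓ` on a full neighbourhood of each `u`, for `s` far along `𝓕`;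
compactness does the rest. -/
theorem IsCadlagAlong.exists_bound {ℓ : ℝ≥0 → ℝ → ℝ} {t : ℝ≥0} {𝓕 : Filter ℝ≥0}
    (h : IsCadlagAlong ℓ t 𝓕) (R : ℝ) :
    ∃ C, ∀ᶠ s in 𝓕, ∀ u ∈ Icc (-R) R, |ℓ s u| ≤ C := by
  refine (isCompact_Icc (a := -R) (b := R)).induction_on
    (p := fun A => ∃ C, ∀ᶠ s in 𝓕, ∀ u ∈ A, |ℓ s u| ≤ C) ?_ ?_ ?_ ?_
  · exact ⟨0, by simp⟩
  · rintro A B hAB ⟨C, hC⟩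
    exact ⟨C, hC.mono fun s hs u hu => hs u (hAB hu)⟩
  · rintro A B ⟨C, hC⟩ ⟨D, hD⟩
    refine ⟨max C D, (hC.and hD).mono ?_⟩
    rintro s ⟨h1, h2⟩ u (hu | hu)
    · exact (h1 u hu).trans (le_max_left _ _)
    · exact (h2 u hu).trans (le_max_right _ _)
  · intro u _
    obtain ⟨h1, l, h2⟩ := h u
    have h3 : ∀ᶠ p in 𝓕 ×ˢ 𝓝 u, |ℓ p.1 p.2| ≤ max (|ℓ t u| + 1) (|l| + 1) := by
      rw [← nhdsLT_sup_nhdsGE, prod_sup, eventually_sup]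
      constructor
      · filter_upwards [h2.abs.eventually (gt_mem_nhds (lt_add_one |l|))] with p hp
        exact hp.le.trans (le_max_right _ _)
      · filter_upwards [h1.abs.eventually (gt_mem_nhds (lt_add_one |ℓ t u|))] with p hp
        exact hp.le.trans (le_max_left _ _)
    obtain ⟨p, hp, q, hq, hpq⟩ := eventually_prod_iff.1 h3
    exact ⟨{v | q v}, mem_nhdsWithin_of_mem_nhds hq, _, hp.mono fun s hs v hv => hpq hs hv⟩

/-- Convergence of integrals of a càdlàg family under right shifts that tend to zero. -/
theorem IsCadlagAlong.tendsto_integral {ℓ : ℝ≥0 → ℝ → ℝ} {t : ℝ≥0} {𝓕 : Filter ℝ≥0}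
    (h : IsCadlagAlong ℓ t 𝓕) {R S : ℝ} (hmeas : ∀ s, Measurable (ℓ s))
    (hzero : ∀ᶠ s in 𝓕, ∀ u ∉ Icc (-R) R, ℓ s u = 0) {γ ν : Measure ℝ} [IsProbabilityMeasure γ]
    [IsLocallyFiniteMeasure ν] [SigmaFinite ν] (hγ : ∀ᵐ w ∂γ, w ∈ Icc 0 S)
    {ι : Type*} {l : Filter ι} [l.IsCountablyGenerated] {s : ι → ℝ≥0} {θ : ι → ℝ}
    (hs : Tendsto s l 𝓕) (hθ0 : ∀ i, 0 ≤ θ i) (hθ : Tendsto θ l (𝓝 0)) :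
    Tendsto (fun i => ∫ p, ℓ (s i) (p.2 + θ i * p.1) ∂(γ.prod ν)) l
      (𝓝 (∫ u, ℓ t u ∂ν)) := by
  obtain ⟨C, hC⟩ := h.exists_bound R
  have hlim : ∫ u, ℓ t u ∂ν = ∫ p : ℝ × ℝ, ℓ t p.2 ∂(γ.prod ν) := by
    rw [integral_fun_snd]
    simp
  have hγ' : ∀ᵐ p ∂(γ.prod ν), p.1 ∈ Icc 0 S := Measure.quasiMeasurePreserving_fst.ae hγ
  rw [hlim]
  -- Once `θ i < 1`, the shift lies in `[0, S]`, so a shifted point in `[-R, R]` comes from `[-R -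
  -- S, R]`.
  refine tendsto_integral_filter_of_dominated_convergence
    ((Icc (-R - S) R).indicator (fun _ => max C 0) ∘ Prod.snd) ?_ ?_ ?_ ?_
  · exact Eventually.of_forall fun i =>
      ((hmeas (s i)).comp (by fun_prop)).aestronglyMeasurable
  · filter_upwards [hs.eventually hC, hs.eventually hzero,
      hθ.eventually (gt_mem_nhds one_pos)] with i hCi hzi hθi
    filter_upwards [hγ'] with p hp
    rw [Real.norm_eq_abs, comp_apply]
    by_cases hu : p.2 + θ i * p.1 ∈ Icc (-R) R
    · have h1 : 0 ≤ θ i * p.1 := mul_nonneg (hθ0 i) hp.1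
      have h2 : θ i * p.1 ≤ S := by nlinarith [hp.1, hp.2]
      rw [indicator_of_mem (show p.2 ∈ Icc (-R - S) R from
        ⟨by linarith [hu.1], by linarith [hu.2]⟩)]
      exact (hCi _ hu).trans (le_max_left _ _)
    · rw [hzi _ hu, abs_zero]
      exact indicator_nonneg (fun _ _ => le_max_right _ _) _
  · refine Integrable.comp_snd (f := (Icc (-R - S) R).indicator fun _ => max C 0) ?_ γ
    rw [integrable_indicator_iff measurableSet_Icc]
    exact integrableOn_const isCompact_Icc.measure_lt_top.ne
  · filter_upwards [hγ'] with p hp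
    refine (h p.2).1.comp (hs.prodMk (tendsto_nhdsWithin_iff.2 ⟨?_, Eventually.of_forall fun i => ?_⟩))
    · simpa using (tendsto_const_nhds (x := p.2)).add (hθ.mul_const p.1)
    · exact le_add_of_nonneg_right (mul_nonneg (hθ0 i) hp.1)

/-- Smoothings of a continuous function converge continuously to it. -/
theorem tendsto_integral_comp_sub_mul {f : ℝ → ℝ} (hf : Continuous f) {γ : Measure ℝ}
    [IsProbabilityMeasure γ] {S : ℝ} (hγ : ∀ᵐ w ∂γ, w ∈ Icc 0 S)
    {ι : Type*} {l : Filter ι} [l.IsCountablyGenerated] {y θ : ι → ℝ} {a : ℝ}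
    (hy : Tendsto y l (𝓝 a)) (hθ0 : ∀ i, 0 ≤ θ i) (hθ : Tendsto θ l (𝓝 0)) :
    Tendsto (fun i => ∫ w, f (y i - θ i * w) ∂γ) l (𝓝 (f a)) := by
  obtain ⟨C, hC⟩ := (isCompact_Icc (a := a - 1 - S) (b := a + 1)).exists_bound_of_continuousOn
    hf.continuousOn
  have hlim : f a = ∫ _, f a ∂γ := by simp
  rw [hlim]
  refine tendsto_integral_filter_of_dominated_convergence (fun _ => C) ?_ ?_
    (integrable_const _) ?_
  · exact Eventually.of_forall fun i => (hf.comp (by fun_prop)).aestronglyMeasurable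
  · filter_upwards [hy.eventually (Ioo_mem_nhds (sub_one_lt a) (lt_add_one a)),
      hθ.eventually (gt_mem_nhds one_pos)] with i hyi hθi
    filter_upwards [hγ] with w hw
    have h1 : 0 ≤ θ i * w := mul_nonneg (hθ0 i) hw.1
    have h2 : θ i * w ≤ S := by nlinarith [hw.1, hw.2]
    exact hC _ ⟨by linarith [hyi.1], by linarith [hyi.2]⟩
  · refine Eventually.of_forall fun w => (hf.tendsto a).comp ?_
    simpa using hy.sub (hθ.mul_const w)

theorem integrable_of_isCadlag {φ : ℝ → ℝ} (hφ : IsCadlag φ) {R : ℝ}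
    (hzero : ∀ u ∉ Icc (-R) R, φ u = 0) {ν : Measure ℝ} [IsLocallyFiniteMeasure ν] :
    Integrable φ ν := by
  have hm := measurable_of_continuousWithinAt_Ici fun u => (hφ u).1
  -- A constant family, with dummy time `0`, turns the bound for families into one for `φ`.
  obtain ⟨C, hC⟩ := (isCadlagAlong_pure (ℓ := fun _ => φ) (t := 0) hφ).exists_bound R
  rw [eventually_pure] at hC
  have hind : φ = (Icc (-R) R).indicator φ :=
    (indicator_eq_self.2 fun u hu => by_contra fun h => hu (hzero u h)).symm
  rw [hind, integrable_indicator_iff measurableSet_Icc]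
  exact Measure.integrableOn_of_bounded isCompact_Icc.measure_lt_top.ne hm.aestronglyMeasurable
    ((ae_restrict_iff' measurableSet_Icc).2 (Eventually.of_forall hC))

end PathwiseTanaka

/-! ### The generalised Itô–Tanaka formula -/

open PathwiseTanaka in
theorem theorem5p1
    (P : ℕ → TimePartition) (x : ℝ≥0 → ℝ) (hx : MemLOne P x)
    (L : ℝ≥0 → Lp ℝ 1 (volume : Measure ℝ)) (hL : IsPathwiseLocalTime P x L)
    (ℓ : ℝ≥0 → ℝ → ℝ) (hmod : ∀ t, ℓ t =ᵐ[volume] L t) (hcadlag : ∀ t, IsCadlag (ℓ t))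
    (f : ℝ → ℝ) (hf : ConvexOn ℝ univ f) :
    ∃ J : ℝ≥0 → ℝ,
      (∀ g : ℝ → ℝ, IsMollifier g →
        (∀ n : ℕ, ContDiff ℝ 2 (mollify g f n)) ∧
        ∃ I : ℕ → ℝ≥0 → ℝ,
          (∀ n, IsFollmerIntegral P x (deriv (mollify g f n)) (I n)) ∧
          (∀ t, Tendsto (fun n => I n t) atTop (𝓝 (J t))) ∧
          (IsJointlyContinuousCadlag ℓ →
            ∀ K : Set ℝ≥0, IsCompact K → TendstoUniformlyOn I J atTop K)) ∧
      (∀ t, Integrable (ℓ t) (secondDeriv f hf) ∧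
        f (x t) - f (x 0) = J t + 1 / 2 * ∫ u, ℓ t u ∂(secondDeriv f hf)) ∧
      (IsJointlyContinuousCadlag ℓ → Continuous J) := by
  have hfc := continuous_of_convexOn_univ hf
  have hmeas : ∀ s, Measurable (ℓ s) := fun s =>
    measurable_of_continuousWithinAt_Ici fun u => (hcadlag s u).1
  have hzero : ∀ T R, (∀ s ≤ T, |x s| ≤ R) → ∀ s ≤ T, ∀ u ∉ Icc (-R) R, ℓ s u = 0 := by
    intro T R hR s hs u hu
    refine eq_zero_of_ae_eq_zero_off_Icc (fun v => (hcadlag s v).1) ?_ hu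
    filter_upwards [hL.ae_eq_zero fun r hr => hR r (hr.trans hs), hmod s] with v hv hv' hmem
    rw [hv', hv hmem]
  have hzero' : ∀ t : ℝ≥0, ∃ R, ∀ᶠ s in 𝓝 t, ∀ u ∉ Icc (-R) R, ℓ s u = 0 := by
    intro t
    obtain ⟨R, hR⟩ := exists_bound_path hx.continuous (t + 1)
    refine ⟨R, ?_⟩
    filter_upwards [Iio_mem_nhds (lt_add_of_pos_right t one_pos)] with s hs
    exact hzero _ R hR s (le_of_lt hs)
  -- Defined by the desired formula, `J` is independent of `g` from the outset; what remains is that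
  -- the integrals converge to it.
  let J : ℝ≥0 → ℝ := fun t => f (x t) - f (x 0) - 1 / 2 * ∫ u, ℓ t u ∂(secondDeriv f hf)
  have hJ : IsJointlyContinuousCadlag ℓ → Continuous J := by
    intro hjoint
    refine ((hfc.comp hx.continuous).sub continuous_const).sub
      (continuous_const.mul (continuous_iff_continuousAt.2 fun t => ?_))
    obtain ⟨R, hR⟩ := hzero' t
    -- With no shift and a Dirac mass for `γ`, the limit theorem reduces to continuity in time of
    -- the local time integral.
    have h1 := IsCadlagAlong.tendsto_integral (hjoint t) hmeas hR (γ := Measure.dirac 0)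
      (ν := secondDeriv f hf) (S := 0) (by simp [ae_dirac_eq]) tendsto_id
      (θ := fun _ => 0) (fun _ => le_rfl) tendsto_const_nhds
    refine h1.congr fun s => ?_
    simp only [zero_mul, add_zero, id]
    rw [integral_fun_snd (ℓ s)]
    simp
  refine ⟨J, fun g hg => ?_, fun t => ⟨?_, by simp only [J]; ring⟩, hJ⟩
  · have hC2 := hg.contDiff_mollify hfc
    refine ⟨hC2, ?_⟩
    have := hg.isProbabilityMeasure
    obtain ⟨S, hS0, hS⟩ := hg.exists_ae_mem_Icc
    have hinv : ∀ n : ℕ, (0 : ℝ) ≤ (n : ℝ)⁻¹ := fun n => by positivity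
    have hderiv : ∀ n : ℕ, n ≠ 0 → ∀ u, deriv (mollify g f n) u =
        ∫ w, leftDeriv f (u - (n : ℝ)⁻¹ * w) ∂(densityMeasure g) := fun n hn u =>
      deriv_eq_integral_leftDeriv hf hS (hinv n) (hg.mollify_apply f hn)
        ((hC2 n).differentiable (by norm_num) u)
    have hmono : ∀ n : ℕ, Monotone (deriv (mollify g f n)) := by
      intro n
      rcases eq_or_ne n 0 with rfl | hn
      · have : mollify g f 0 = fun _ => 0 := by
          ext u
          simp [mollify, convolution_def]
        simp [this, monotone_const]
      · rw [funext (hderiv n hn)]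
        exact monotone_integral_comp_sub_mul hS (hinv n) (leftDeriv_monotone hf)
    let I : ℕ → ℝ≥0 → ℝ := fun n t => mollify g f n (x t) - mollify g f n (x 0) -
      1 / 2 * ∫ u, L t u * deriv (deriv (mollify g f n)) u
    have hI : ∀ n, n ≠ 0 → ∀ t, I n t =
        (∫ w, f (x t - (n : ℝ)⁻¹ * w) ∂(densityMeasure g)) -
        (∫ w, f (x 0 - (n : ℝ)⁻¹ * w) ∂(densityMeasure g)) -
        1 / 2 * ∫ p, ℓ t (p.2 + (n : ℝ)⁻¹ * p.1) ∂((densityMeasure g).prod (secondDeriv f hf)) := by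
      intro n hn t
      rw [← hg.mollify_apply f hn, ← hg.mollify_apply f hn,
        ← integral_mul_deriv_deriv hf hS (hinv n) (hC2 n) (hderiv n hn) (hmeas t)]
      simp only [I]
      congr 2
      refine integral_congr_ae ?_
      filter_upwards [hmod t] with u hu
      rw [hu]
    -- Used with `pure t` for the limit at fixed time and with `𝓝 t` for continuous convergence.
    -- Dominated convergence needs the filter to be countably generated.
    have hlim : ∀ (t : ℝ≥0) (𝓕 : Filter ℝ≥0) [𝓕.IsCountablyGenerated], 𝓕 ≤ 𝓝 t →
        IsCadlagAlong ℓ t 𝓕 →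
        Tendsto (fun p : ℕ × ℝ≥0 => I p.1 p.2) (atTop ×ˢ 𝓕) (𝓝 (J t)) := by
      intro t 𝓕 _ h𝓕 hℓ
      obtain ⟨R, hR⟩ := hzero' t
      have hθ : Tendsto (fun p : ℕ × ℝ≥0 => (p.1 : ℝ)⁻¹) (atTop ×ˢ 𝓕) (𝓝 0) :=
        tendsto_inv_atTop_nhds_zero_nat.comp tendsto_fst
      have hs : Tendsto (fun p : ℕ × ℝ≥0 => p.2) (atTop ×ˢ 𝓕) 𝓕 := tendsto_snd
      have hy : Tendsto (fun p : ℕ × ℝ≥0 => x p.2) (atTop ×ˢ 𝓕) (𝓝 (x t)) :=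
        (hx.continuous.tendsto t).comp (hs.mono_right h𝓕)
      have hθ0 : ∀ p : ℕ × ℝ≥0, (0 : ℝ) ≤ (p.1 : ℝ)⁻¹ := fun p => hinv p.1
      have h1 := tendsto_integral_comp_sub_mul hfc hS hy hθ0 hθ
      have h2 := tendsto_integral_comp_sub_mul hfc hS
        (tendsto_const_nhds (x := x 0) (f := atTop ×ˢ 𝓕)) hθ0 hθ
      have h3 := hℓ.tendsto_integral hmeas (h𝓕 hR) (ν := secondDeriv f hf) hS hs hθ0 hθ
      refine ((h1.sub h2).sub (h3.const_mul (1 / 2))).congr' ?_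
      filter_upwards [tendsto_fst.eventually (eventually_ne_atTop 0)] with p hp
      rw [hI p.1 hp]
    refine ⟨I, fun n => hL.isFollmerIntegral_deriv hx.continuous hx.oscillation_tendsto (hC2 n)
      (hmono n), fun t => ?_, fun hjoint K hK => ?_⟩
    · have := hlim t (pure t) (pure_le_nhds t) (isCadlagAlong_pure (hcadlag t))
      rw [prod_pure, tendsto_map'_iff] at this
      exact this
    · exact tendstoUniformlyOn_of_tendsto_prod_nhds (hJ hjoint)
        (fun t => hlim t (𝓝 t) le_rfl (hjoint t)) hK
  · obtain ⟨R, hR⟩ := exists_bound_path hx.continuous t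
    exact integrable_of_isCadlag (hcadlag t) (hzero t R hR t le_rfl)
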